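/- **Theorem (bijection for Shi faces).** Let $n\ge 1$ and $[n]=\{1,\dots,n\}$. *Arrangements and faces.* The Shi arrangement in $\mathbb{R}^n$ consists of the hyperplanes $x_i-x_j=0$ and $x_i-x_j=1$ for $1\le i<j\le n$; the Catalan arrangement consists of the hyperplanes $x_i-x_j=0$ and $x_i-x_j=1$ for all $i\ne j$ in $[n]$. A face of an arrangement is a non-empty solution set of a system that contains, for each hyperplane $x_i-x_j=s$, exactly one of $x_i-x_j<s$, $x_i-x_j=s$, $x_i-x_j>s$. The dimension of a face is the dimension of its affine span. *Trees.* A binary tree is a rooted plane tree in which every vertex has either $2$ children (a node) or $0$ children (a leaf). An internal edge is an edge between two nodes. An $[n]$-decorated binary tree is a binary tree in which each node is labeled by a non-empty subset of $[n]$, so that every $i\in[n]$ lies in the label of exactly one node, and in which every right internal edge is declared either solid or dashed. A node is captive if it is joined to its parent by a dashed edge, and free otherwise. The tree is of Shi type if every right internal edge, with parent label $A$ and child label $B$, is a descent: $\max A>\min B$. For a vertex $v$ let $\rho(v)$ be the word in the letters $E_0$ (left edge) and $E_1$ (right edge) encoding the path from the root to $v$, and let $\dot\rho(v)$ be the number of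 letters $E_1$ in it. For vertices $v\neq w$ of $T$ put $v\prec_T w$ if $\dot\rho(v)<\dot\rho(w)$, or if $\dot\rho(v)=\dot\rho(w)$ and either $\rho(v)$ is a proper prefix of $\rho(w)$ or, at the first index where the two words differ, $\rho(v)$ has $E_1$ and $\rho(w)$ has $E_0$. Let $v_T(i)$ be the node whose label contains $i$, and $v^1_T(i)$ the right child of $v_T(i)$. *Statement.* For every $[n]$-decorated binary tree $T$ of Shi type there is a unique Shi face $\Phi(T)$ consisting of all points $p\in\mathbb{R}^n$ such that 1. for all $i,j\in[n]$: $p_i\le p_j$ if and only if $v_T(i)\preceq_T v_T(j)$; 2. for all $1\le i<j\le n$: $p_i<p_j+1$ if and only if $v_T(i)\prec_T v^1_T(j)$; 3. for all $1\le i<j\le n$: $p_i=p_j+1$ if and only if $v_T(i)=v^1_T(j)$ and $v^1_T(j)$ is captive. The map $T\mapsto\Phi(T)$ is a bijection from the set of $[n]$-decorated binary trees of Shi type to the set of Shi faces in $\mathbb{R}^n$. For every such $T$ and every integer $k\ge 0$, the tree $T$ has exactly $k$ free nodes if and only if $\Phi(T)$ has dimension $k$. Moreover, for every such $T$, the set of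 points $p$ satisfying 1, 2 and 3 with the conditions in 2 and 3 imposed for all $i,j\in[n]$ is a Catalan face (the Catalan face of $T$), and $\Phi(T)$ is the unique Shi face that contains it. -/

import Mathlib

/-!
Conventions.  The set `[n] = {1, …, n}` is modelled by `Fin n` with its order.  A vertex of a binary
tree is given by its address, the word recording the path from the root: `false` is the letter `E₀`
(take the left edge) and `true` is the letter `E₁` (take the right edge).
-/

/-- The data carried by a node: its label (a subset of `[n]`), and whether the edge to its
right-child is dashed. -/
@[ext] structure NodeDecoration (n : ℕ) where
  label : Finset (Fin n)
  rightDashed : Bool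

/-- The value stored at the node with address `v`, if the vertex `v` exists and is a node
(and not a leaf). The constructors `node` and `nil` of `BinaryTree` are the nodes and the leaves of
a binary tree each of whose vertices has `2` or `0` children. -/
def BinaryTree.valueAt {α : Type*} : BinaryTree α → List Bool → Option α
  | .nil, _ => none
  | .node a _ _, [] => some a
  | .node _ l _, false :: v => l.valueAt v
  | .node _ _ r, true :: v => r.valueAt v

/-- `[n]`-decorated binary trees: the labels are non-empty and partition `[n]`
(each `i` lies in the label of exactly one node), and only right internal edges can be dashed. -/
@[ext] structure DecoratedBinaryTree (n : ℕ) where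
  tree : BinaryTree (NodeDecoration n)
  label_nonempty : ∀ v d, tree.valueAt v = some d → d.label.Nonempty
  existsUnique_node : ∀ i : Fin n, ∃! v : List Bool, ∃ d, tree.valueAt v = some d ∧ i ∈ d.label
  dashed_internal : ∀ v d, tree.valueAt v = some d → d.rightDashed = true →
    ∃ e, tree.valueAt (v ++ [true]) = some e

/-- The number of right-edges in the path from the root to the vertex `v`. -/
def rhoDot (v : List Bool) : ℕ := v.count true

/-- The order `≺_T` on vertices, which depends only on their addresses. -/
def VertexLT (v w : List Bool) : Prop :=
  rhoDot v < rhoDot w ∨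
    (rhoDot v = rhoDot w ∧
      ((v <+: w ∧ v ≠ w) ∨ ∃ u a b, v = u ++ true :: a ∧ w = u ++ false :: b))

/-- The order `⪯_T`. -/
def VertexLE (v w : List Bool) : Prop := VertexLT v w ∨ v = w

namespace DecoratedBinaryTree

variable {n : ℕ} (T : DecoratedBinaryTree n)

/-- The vertex `v` is a node of `T`. -/
def IsNode (v : List Bool) : Prop := ∃ d, T.tree.valueAt v = some d

/-- A captive node: a node joined to its parent by a dashed edge. -/
def IsCaptive (v : List Bool) : Prop :=
  T.IsNode v ∧ ∃ u d, v = u ++ [true] ∧ T.tree.valueAt u = some d ∧ d.rightDashed = true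

/-- A free node: a node that is not captive. -/
def IsFree (v : List Bool) : Prop := T.IsNode v ∧ ¬ T.IsCaptive v

/-- The number of free nodes. -/
noncomputable def numFree : ℕ := {v | T.IsFree v}.ncard

/-- `v_T(i)`: the unique node whose label contains `i`. -/
noncomputable def nodeOf (i : Fin n) : List Bool := (T.existsUnique_node i).choose

/-- `v¹_T(i)`: the right-child of `v_T(i)`. -/
noncomputable def rightChildOf (i : Fin n) : List Bool := T.nodeOf i ++ [true]

/-- Shi type: every right internal edge is a descent, that is, `max A > min B`, where `A` is the
label of the parent and `B` the label of the child. -/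
def IsShiType : Prop :=
  ∀ (v : List Bool) (d e : NodeDecoration n) (hd : T.tree.valueAt v = some d)
    (he : T.tree.valueAt (v ++ [true]) = some e),
    d.label.max' (T.label_nonempty v d hd) > e.label.min' (T.label_nonempty (v ++ [true]) e he)

/-- The three conditions on a point `p` that define the Shi face of `T`. -/
def ShiConditions (p : Fin n → ℝ) : Prop :=
  (∀ i j, p i ≤ p j ↔ VertexLE (T.nodeOf i) (T.nodeOf j)) ∧
  (∀ i j, i < j → (p i < p j + 1 ↔ VertexLT (T.nodeOf i) (T.rightChildOf j))) ∧
  (∀ i j, i < j →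
    (p i = p j + 1 ↔ T.nodeOf i = T.rightChildOf j ∧ T.IsCaptive (T.rightChildOf j)))

/-- The three conditions on a point `p` that define the Catalan face of `T`. -/
def CatalanConditions (p : Fin n → ℝ) : Prop :=
  (∀ i j, p i ≤ p j ↔ VertexLE (T.nodeOf i) (T.nodeOf j)) ∧
  (∀ i j, p i < p j + 1 ↔ VertexLT (T.nodeOf i) (T.rightChildOf j)) ∧
  (∀ i j, p i = p j + 1 ↔ T.nodeOf i = T.rightChildOf j ∧ T.IsCaptive (T.rightChildOf j))

end DecoratedBinaryTree

/-- The nodes of a binary tree are finite in number. -/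
theorem BinaryTree.finite_nodes {α : Type*} (t : BinaryTree α) :
    {v : List Bool | ∃ a, t.valueAt v = some a}.Finite := by
  induction t with
  | nil => simp [BinaryTree.valueAt]
  | node a l r hl hr =>
    refine (((hl.image (List.cons false)).union (hr.image (List.cons true))).union
      (Set.finite_singleton [])).subset ?_
    rintro v ⟨b, hb⟩
    match v with
    | [] => simp
    | false :: v => exact Or.inl (Or.inl ⟨v, ⟨b, hb⟩, rfl⟩)
    | true :: v => exact Or.inl (Or.inr ⟨v, ⟨b, hb⟩, rfl⟩)

/-- The triple `(i, j, s)` stands for the hyperplane `x_i - x_j = s` of `ℝⁿ`.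
The Shi arrangement: `x_i - x_j = 0, 1` for `i < j`. -/
def shiArrangement (n : ℕ) : Set (Fin n × Fin n × ℝ) :=
  {h | h.1 < h.2.1 ∧ (h.2.2 = 0 ∨ h.2.2 = 1)}

/-- The Catalan arrangement: `x_i - x_j = 0, 1` for all `i ≠ j`. -/
def catalanArrangement (n : ℕ) : Set (Fin n × Fin n × ℝ) :=
  {h | h.1 ≠ h.2.1 ∧ (h.2.2 = 0 ∨ h.2.2 = 1)}

/-- A face of an arrangement of hyperplanes `x_i - x_j = s`: the solution set, required to be
non-empty, of a system that contains for each hyperplane exactly one of `x_i - x_j < s`,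
`x_i - x_j = s`, `x_i - x_j > s`, as chosen by `δ`. -/
def IsFace {n : ℕ} (A : Set (Fin n × Fin n × ℝ)) (F : Set (Fin n → ℝ)) : Prop :=
  F.Nonempty ∧ ∃ δ : Fin n × Fin n × ℝ → SignType,
    F = {x | ∀ h ∈ A, SignType.sign (x h.1 - x h.2.1 - h.2.2) = δ h}

/-- The dimension of the affine span. -/
noncomputable def affineDim {n : ℕ} (F : Set (Fin n → ℝ)) : ℕ :=
  Module.finrank ℝ (affineSpan ℝ F).direction

/-! The order `≺_T` is the lexicographic order on pairs (number of right edges, depth-first word),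
encoded by `vertexKey`. It has three useful properties: the left child of `v` is the immediate
successor of `v` among all words; passing to right children preserves the order; and the right child
of `v` is weakly below `w E₁ E₀^t` exactly when `v` is weakly below `w`.

Faces are non-empty: give a node `v` the value `rhoDot v + freeCount v / (numFree + 1)`. A captive
node has the same count as its parent, so it lies exactly 1 higher; no other coincidences occur.
This point satisfies even the Catalan conditions (`catalanConditions_catalanPoint`), and a face is
determined by any of its points.

Dimension: the difference of two points of a Shi face is constant along chains of dashed edges, and
any small perturbation of the Catalan point with this property stays in the Shi face. This leaves
one parameter per free node.

Injectivity: every right internal edge contains a pair `a < b` with `a` in the child and `b` in the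
parent. Hence the Shi face, which only constrains pairs `i < j`, determines the comparison of every
node with every right child (`IsShiType.append_true_le_iff`), and these comparisons determine all
addresses (`nodeOf_congr`).

Surjectivity: sort the values of a point into blocks. The number of right children weakly before
each block, forced by the pairs `a < b` with `p b + 1 ≤ p a`, yields the addresses recursively
(`nodeAddress`), and each right edge so created is a descent. -/

/-! ### The orders on addresses -/

/-- The word over `ℕ` whose lexicographic order is the depth-first order (right subtree first). -/
def dfsWord (v : List Bool) : List ℕ := v.map fun b => if b then 0 else 1

@[simp] theorem dfsWord_nil : dfsWord [] = [] := rfl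

@[simp] theorem dfsWord_true_cons (v : List Bool) : dfsWord (true :: v) = 0 :: dfsWord v := rfl

@[simp] theorem dfsWord_false_cons (v : List Bool) : dfsWord (false :: v) = 1 :: dfsWord v := rfl

theorem dfsWord_injective : Function.Injective dfsWord :=
  List.map_injective_iff.2 (by decide)

@[simp] theorem rhoDot_nil : rhoDot [] = 0 := rfl

@[simp] theorem rhoDot_true_cons (v : List Bool) : rhoDot (true :: v) = rhoDot v + 1 := by
  simp [rhoDot]

@[simp] theorem rhoDot_false_cons (v : List Bool) : rhoDot (false :: v) = rhoDot v := by
  simp [rhoDot]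

@[simp] theorem rhoDot_append (v w : List Bool) : rhoDot (v ++ w) = rhoDot v + rhoDot w := by
  simp [rhoDot]

@[simp] theorem rhoDot_replicate_false (t : ℕ) : rhoDot (List.replicate t false) = 0 := by
  simp [rhoDot, List.count_replicate]

theorem dfsWord_lt_iff (v w : List Bool) : dfsWord v < dfsWord w ↔
    (v <+: w ∧ v ≠ w) ∨ ∃ u a b, v = u ++ true :: a ∧ w = u ++ false :: b := by
  constructor
  · intro h
    induction v generalizing w with
    | nil =>
      cases w with
      | nil => simp at h
      | cons b w => exact Or.inl ⟨List.nil_prefix, by simp⟩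
    | cons a v ih =>
      cases w with
      | nil => simp at h
      | cons b w =>
        have key : dfsWord v < dfsWord w → a = b →
            (a :: v <+: b :: w ∧ a :: v ≠ b :: w) ∨
              ∃ u x y, a :: v = u ++ true :: x ∧ b :: w = u ++ false :: y := by
          rintro hlt rfl
          rcases ih w hlt with ⟨h1, h2⟩ | ⟨u, x, y, rfl, rfl⟩
          · exact Or.inl ⟨(List.prefix_cons_inj a).2 h1, by simpa using h2⟩
          · exact Or.inr ⟨a :: u, x, y, rfl, rfl⟩
        cases a <;> cases b <;> simp [List.cons_lt_cons_iff] at h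
        · exact key h rfl
        · exact Or.inr ⟨[], v, w, rfl, rfl⟩
        · exact key h rfl
  · rintro (⟨⟨u, rfl⟩, h⟩ | ⟨u, a, b, rfl, rfl⟩)
    · induction v with
      | nil =>
        cases u with
        | nil => simp at h
        | cons b u => cases b <;> simp
      | cons a v ih =>
        have := ih (by simpa using h)
        cases a <;> simpa [List.cons_lt_cons_iff] using this
    · induction u with
      | nil => simp [List.cons_lt_cons_iff]
      | cons c u ih => cases c <;> simpa [List.cons_lt_cons_iff] using ih

/-- If `v` is a proper prefix of `w`, equal numbers of right edges force the rest of `w` to consist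
of left edges only. Otherwise the words already differ inside `v`, and appending a letter changes
nothing. -/
theorem dfsWord_append_false_le {v w : List Bool} (h : dfsWord v < dfsWord w)
    (hr : rhoDot v = rhoDot w) : dfsWord (v ++ [false]) ≤ dfsWord w := by
  rw [← not_lt]
  induction v generalizing w with
  | nil =>
    cases w with
    | nil => simp at h
    | cons b w => cases b <;> simp at hr ⊢
  | cons a v ih =>
    cases w with
    | nil => simp at h
    | cons b w =>
      cases a <;> cases b <;>
        simp only [dfsWord_true_cons, dfsWord_false_cons, rhoDot_true_cons, rhoDot_false_cons,
          List.cons_append, List.cons_lt_cons_iff] at h hr ⊢ <;> grind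

/-- In the prefix case `w` extends `v` by left edges only, so the appended right edge of `v` meets a
left edge of `w` and comes first. -/
theorem dfsWord_append_true_lt {v w : List Bool} (h : dfsWord v < dfsWord w)
    (hr : rhoDot v = rhoDot w) (a b : List Bool) :
    dfsWord (v ++ true :: a) < dfsWord (w ++ true :: b) := by
  induction v generalizing w with
  | nil =>
    cases w with
    | nil => simp at h
    | cons c w => cases c <;> simp [List.cons_lt_cons_iff] at hr ⊢
  | cons c v ih =>
    cases w with
    | nil => simp at h
    | cons d w =>
      cases c <;> cases d <;>
        simp [List.cons_lt_cons_iff] at h hr ih ⊢ <;> exact ih h hr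

/-- The right child is the immediate successor in depth-first order, as right subtrees are visited
first. -/
theorem dfsWord_lt_append_true_iff {v w : List Bool} :
    dfsWord v < dfsWord (w ++ [true]) ↔ dfsWord v ≤ dfsWord w := by
  rw [← not_lt (a := dfsWord w)]
  induction w generalizing v with
  | nil =>
    cases v with
    | nil => simp
    | cons a v => cases a <;> simp [List.cons_lt_cons_iff]
  | cons b w ih =>
    cases v with
    | nil => cases b <;> simp
    | cons a v =>
      cases a <;> cases b <;> simp [List.cons_lt_cons_iff, ih]

/-- A key in a linear order that induces the order `≺_T`. -/
def vertexKey (v : List Bool) : ℕ ×ₗ List ℕ := toLex (rhoDot v, dfsWord v)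

theorem vertexKey_injective : Function.Injective vertexKey := by
  intro v w h
  simp only [vertexKey, EmbeddingLike.apply_eq_iff_eq, Prod.mk.injEq] at h
  exact dfsWord_injective h.2

theorem vertexKey_lt_iff {v w : List Bool} : vertexKey v < vertexKey w ↔
    rhoDot v < rhoDot w ∨ rhoDot v = rhoDot w ∧ dfsWord v < dfsWord w := by
  simp [vertexKey, Prod.Lex.toLex_lt_toLex]

theorem vertexLT_iff {v w : List Bool} : VertexLT v w ↔ vertexKey v < vertexKey w := by
  rw [vertexKey_lt_iff, dfsWord_lt_iff]; rfl

theorem vertexLE_iff {v w : List Bool} : VertexLE v w ↔ vertexKey v ≤ vertexKey w := by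
  rw [VertexLE, vertexLT_iff, le_iff_lt_or_eq, vertexKey_injective.eq_iff]

theorem vertexKey_nil_le (v : List Bool) : vertexKey [] ≤ vertexKey v := by
  rcases eq_or_ne v [] with rfl | hv
  · exact le_rfl
  · rw [← vertexLE_iff]
    refine Or.inl ?_
    rcases Nat.eq_zero_or_pos (rhoDot v) with h | h
    · exact Or.inr ⟨h.symm, Or.inl ⟨List.nil_prefix, hv.symm⟩⟩
    · exact Or.inl h

theorem vertexKey_lt_append_false (v : List Bool) : vertexKey v < vertexKey (v ++ [false]) :=
  vertexLT_iff.1 (Or.inr ⟨by simp, Or.inl ⟨List.prefix_append _ _, by simp⟩⟩)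

theorem vertexKey_append_false_le_iff {v w : List Bool} :
    vertexKey (v ++ [false]) ≤ vertexKey w ↔ vertexKey v < vertexKey w := by
  refine ⟨(vertexKey_lt_append_false v).trans_le, fun h => ?_⟩
  rcases vertexKey_lt_iff.1 h with h | ⟨h, h'⟩
  · exact (vertexKey_lt_iff.2 (Or.inl (by simpa using h))).le
  · exact Prod.Lex.toLex_le_toLex.2 (Or.inr ⟨by simpa using h, dfsWord_append_false_le h' h⟩)

theorem vertexKey_append_true_lt {v w : List Bool} (h : vertexKey v < vertexKey w) (s t : ℕ) :
    vertexKey (v ++ true :: List.replicate s false) <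
      vertexKey (w ++ true :: List.replicate t false) := by
  rw [vertexKey_lt_iff] at h ⊢
  rcases h with h | ⟨h, h'⟩
  · left; simpa using h
  · exact Or.inr ⟨by simpa using h, dfsWord_append_true_lt h' h _ _⟩

theorem vertexKey_append_true_lt_iff {v w : List Bool} :
    vertexKey (v ++ [true]) < vertexKey (w ++ [true]) ↔ vertexKey v < vertexKey w := by
  have key : ∀ {v w : List Bool}, vertexKey v < vertexKey w →
    vertexKey (v ++ [true]) < vertexKey (w ++ [true]) := fun h => vertexKey_append_true_lt h 0 0
  refine ⟨fun h => ?_, key⟩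
  rcases lt_trichotomy (vertexKey v) (vertexKey w) with h' | h' | h'
  · exact h'
  · rw [vertexKey_injective h'] at h; exact absurd h (lt_irrefl _)
  · exact absurd (key h') h.not_gt

theorem vertexKey_append_true_le_iff {v w : List Bool} :
    vertexKey (v ++ [true]) ≤ vertexKey (w ++ [true]) ↔ vertexKey v ≤ vertexKey w := by
  rw [← not_lt, vertexKey_append_true_lt_iff, not_lt]

theorem vertexKey_le_append_replicate_false (v : List Bool) (t : ℕ) :
    vertexKey v ≤ vertexKey (v ++ List.replicate t false) := by
  induction t with
  | zero => simp
  | succ t ih =>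
    rw [List.replicate_succ', ← List.append_assoc]
    exact ih.trans (vertexKey_lt_append_false _).le

/-- Every word with a right edge has the form on the right-hand side, so this reduces comparisons
between right children and nodes to comparisons between nodes. -/
theorem vertexKey_append_true_le_append_iff {v w : List Bool} {t : ℕ} :
    vertexKey (v ++ [true]) ≤ vertexKey (w ++ true :: List.replicate t false) ↔
      vertexKey v ≤ vertexKey w := by
  constructor
  · intro h
    by_contra! h'
    exact (vertexKey_append_true_lt h' t 0).not_ge h
  · intro h
    refine (vertexKey_append_true_le_iff.2 h).trans ?_
    simpa using vertexKey_le_append_replicate_false (w ++ [true]) t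

theorem exists_eq_append_true_replicate {v : List Bool} (h : 0 < rhoDot v) :
    ∃ u t, v = u ++ true :: List.replicate t false := by
  induction v using List.reverseRecOn with
  | nil => simp at h
  | append_singleton v b ih =>
    cases b with
    | true => exact ⟨v, 0, rfl⟩
    | false =>
      obtain ⟨u, t, rfl⟩ := ih (by simpa using h)
      exact ⟨u, t + 1, by simp [List.replicate_succ']⟩

theorem not_vertexKey_append_true_le_replicate_false (v : List Bool) (t : ℕ) :
    ¬ vertexKey (v ++ [true]) ≤ vertexKey (List.replicate t false) := by
  rw [not_le, vertexKey_lt_iff]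
  left; simp

/-! ### Binary trees and their addresses -/

namespace BinaryTree

variable {α : Type*}

theorem exists_valueAt_of_append {t : BinaryTree α} {v w : List Bool} {a : α}
    (h : t.valueAt (v ++ w) = some a) : ∃ b, t.valueAt v = some b := by
  induction v generalizing t with
  | nil =>
    cases t with
    | nil => simp [valueAt] at h
    | node b l r => exact ⟨b, rfl⟩
  | cons c v ih =>
    cases t with
    | nil => simp [valueAt] at h
    | node b l r => cases c <;> exact ih h

theorem ext_valueAt {t s : BinaryTree α} (h : ∀ v, t.valueAt v = s.valueAt v) : t = s := by
  induction t generalizing s with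
  | nil =>
    cases s with
    | nil => rfl
    | node b l r => simpa [valueAt] using h []
  | node a l r hl hr =>
    cases s with
    | nil => simpa [valueAt] using h []
    | node b l' r' =>
      obtain rfl : a = b := by simpa [valueAt] using h []
      rw [hl fun v => h (false :: v), hr fun v => h (true :: v)]

/-- A bounded partial function on addresses whose domain is prefix-closed comes from a tree. -/
theorem exists_valueAt_eq (N : ℕ) (f : List Bool → Option α)
    (hN : ∀ v, N ≤ v.length → f v = none)
    (hf : ∀ v b, f v = none → f (v ++ [b]) = none) :
    ∃ t : BinaryTree α, ∀ v, t.valueAt v = f v := by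
  induction N generalizing f with
  | zero => exact ⟨nil, fun v => by simp [valueAt, hN v]⟩
  | succ N ih =>
    cases h : f [] with
    | none =>
      refine ⟨nil, fun v => ?_⟩
      induction v using List.reverseRecOn with
      | nil => simp [valueAt, h]
      | append_singleton v b ihv => simpa [valueAt] using (hf v b ihv.symm).symm
    | some a =>
      have sub : ∀ c : Bool, ∃ t : BinaryTree α, ∀ v, t.valueAt v = f (c :: v) := fun c =>
        ih (fun v => f (c :: v)) (fun v hv => hN _ (by simpa using hv))
          fun v b hv => hf (c :: v) b hv
      obtain ⟨l, hl⟩ := sub false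
      obtain ⟨r, hr⟩ := sub true
      refine ⟨node a l r, fun v => ?_⟩
      match v with
      | [] => exact h.symm
      | false :: v => exact hl v
      | true :: v => exact hr v

end BinaryTree

/-! ### Nodes, labels and captivity in a decorated tree -/

namespace DecoratedBinaryTree

variable {n : ℕ} (T : DecoratedBinaryTree n)

theorem nodeOf_spec (i : Fin n) : ∃ d, T.tree.valueAt (T.nodeOf i) = some d ∧ i ∈ d.label :=
  (T.existsUnique_node i).choose_spec.1

variable {T}

theorem nodeOf_eq {v : List Bool} {d : NodeDecoration n} {i : Fin n}
    (h : T.tree.valueAt v = some d) (hi : i ∈ d.label) : T.nodeOf i = v :=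
  ((T.existsUnique_node i).choose_spec.2 v ⟨d, h, hi⟩).symm

theorem mem_label_iff {v : List Bool} {d : NodeDecoration n} {i : Fin n}
    (h : T.tree.valueAt v = some d) : i ∈ d.label ↔ T.nodeOf i = v := by
  refine ⟨nodeOf_eq h, ?_⟩
  rintro rfl
  obtain ⟨e, he, hi⟩ := T.nodeOf_spec i
  rw [h, Option.some_inj] at he
  exact he ▸ hi

theorem isNode_nodeOf (i : Fin n) : T.IsNode (T.nodeOf i) :=
  let ⟨d, hd, _⟩ := T.nodeOf_spec i
  ⟨d, hd⟩

theorem IsNode.exists_nodeOf_eq {v : List Bool} (h : T.IsNode v) : ∃ i, T.nodeOf i = v := by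
  obtain ⟨d, hd⟩ := h
  obtain ⟨i, hi⟩ := T.label_nonempty v d hd
  exact ⟨i, nodeOf_eq hd hi⟩

theorem IsNode.of_append {v w : List Bool} (h : T.IsNode (v ++ w)) : T.IsNode v :=
  BinaryTree.exists_valueAt_of_append h.choose_spec

theorem IsCaptive.exists_eq {v : List Bool} (h : T.IsCaptive v) :
    ∃ u, v = u ++ [true] ∧ T.IsNode u := by
  obtain ⟨-, u, d, rfl, hd, -⟩ := h
  exact ⟨u, rfl, d, hd⟩

theorem isCaptive_append_true_iff {v : List Bool} {d : NodeDecoration n}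
    (h : T.tree.valueAt v = some d) : T.IsCaptive (v ++ [true]) ↔ d.rightDashed = true := by
  constructor
  · rintro ⟨-, u, e, hu, he, hde⟩
    obtain rfl := List.append_cancel_right hu
    rw [h, Option.some_inj] at he
    exact he ▸ hde
  · exact fun hd => ⟨T.dashed_internal v d h hd, v, d, rfl, h, hd⟩

/-- The descents of a tree of Shi type, in terms of the indices in the labels. -/
theorem IsShiType.exists_lt (hT : T.IsShiType) {u : List Bool} (h : T.IsNode (u ++ [true])) :
    ∃ i j, i < j ∧ T.nodeOf i = u ++ [true] ∧ T.nodeOf j = u := by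
  obtain ⟨d, hd⟩ := h.of_append
  obtain ⟨e, he⟩ := h
  exact ⟨_, _, hT u d e hd he, nodeOf_eq he (Finset.min'_mem _ _),
    nodeOf_eq hd (Finset.max'_mem _ _)⟩

/-! ### A point in the Catalan face -/

variable (T)

theorem finite_isFree : {v | T.IsFree v}.Finite :=
  T.tree.finite_nodes.subset fun _ h => h.1

/-- The number of free nodes that come weakly before `v` in depth-first order. -/
noncomputable def freeCount (v : List Bool) : ℕ :=
  {w | T.IsFree w ∧ dfsWord w ≤ dfsWord v}.ncard

theorem freeCount_le (v : List Bool) : T.freeCount v ≤ T.numFree :=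
  Set.ncard_le_ncard (fun _ h => h.1) T.finite_isFree

variable {T}

theorem finite_isFree_le (v : List Bool) : {w | T.IsFree w ∧ dfsWord w ≤ dfsWord v}.Finite :=
  T.finite_isFree.subset fun _ h => h.1

theorem freeCount_mono {u v : List Bool} (h : dfsWord u ≤ dfsWord v) :
    T.freeCount u ≤ T.freeCount v :=
  Set.ncard_le_ncard (fun _ hw => ⟨hw.1, hw.2.trans h⟩) (finite_isFree_le v)

theorem freeCount_lt {u v : List Bool} (h : dfsWord u < dfsWord v) (hv : T.IsFree v) :
    T.freeCount u < T.freeCount v := by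
  refine Set.ncard_lt_ncard ⟨fun _ hw => ⟨hw.1, hw.2.trans h.le⟩, fun hs => ?_⟩
    (finite_isFree_le v)
  exact (hs (show v ∈ {w | T.IsFree w ∧ dfsWord w ≤ dfsWord v} from ⟨hv, le_rfl⟩)).2.not_gt h

/-- Only the right child itself lies after `u` and weakly before `u ++ [true]` in depth-first order,
and it is not free. -/
theorem freeCount_append_true {u : List Bool} (h : T.IsCaptive (u ++ [true])) :
    T.freeCount (u ++ [true]) = T.freeCount u := by
  refine le_antisymm (Set.ncard_le_ncard ?_ (finite_isFree_le u))
    (freeCount_mono (dfsWord_lt_append_true_iff.2 le_rfl).le)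
  rintro w ⟨hw, hle⟩
  refine ⟨hw, dfsWord_lt_append_true_iff.1 (hle.lt_of_ne fun he => ?_)⟩
  exact hw.2 (dfsWord_injective he ▸ h)

theorem exists_of_freeCount_eq {u v : List Bool} (hv : T.IsNode v) (hlt : dfsWord u < dfsWord v)
    (he : T.freeCount u = T.freeCount v) : ∃ x, v = x ++ [true] ∧ T.IsCaptive v ∧
      dfsWord u ≤ dfsWord x ∧ T.freeCount u = T.freeCount x ∧ T.IsNode x := by
  have hc : T.IsCaptive v := by
    by_contra hc
    exact (freeCount_lt hlt ⟨hv, hc⟩).ne he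
  obtain ⟨x, rfl, hx⟩ := hc.exists_eq
  exact ⟨x, rfl, hc, dfsWord_lt_append_true_iff.1 hlt,
    he.trans (freeCount_append_true hc), hx⟩

/-- A free `v` would raise the count, so `v` is captive and its parent has the same count and is
still weakly after `u`. Climbing in this way ends at `u`, and each step removes one right edge. -/
theorem rhoDot_lt_of_freeCount_eq {u v : List Bool} (hv : T.IsNode v)
    (hlt : dfsWord u < dfsWord v) (he : T.freeCount u = T.freeCount v) : rhoDot u < rhoDot v := by
  induction h : v.length using Nat.strong_induction_on generalizing v with
  | _ k ih =>
    obtain ⟨x, rfl, -, hle, hx, hxn⟩ := exists_of_freeCount_eq hv hlt he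
    have hr : rhoDot (x ++ [true]) = rhoDot x + 1 := by simp
    rcases hle.lt_or_eq with hl | hl
    · have := ih x.length (by simp [← h]) hxn hl hx rfl
      omega
    · rw [dfsWord_injective hl]; omega

theorem freeCount_lt_iff {u v : List Bool} (hv : T.IsNode v) (h : rhoDot u = rhoDot v) :
    T.freeCount u < T.freeCount v ↔ dfsWord u < dfsWord v := by
  refine ⟨fun hlt => ?_, fun hlt => (freeCount_mono hlt.le).lt_of_ne fun he =>
    (rhoDot_lt_of_freeCount_eq hv hlt he).ne h⟩
  by_contra! hle
  exact (freeCount_mono hle).not_gt hlt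

theorem freeCount_lt_iff_append_true {u v : List Bool} (hu : T.IsNode u)
    (h : rhoDot v = rhoDot u + 1) :
    T.freeCount v < T.freeCount u ↔ dfsWord v < dfsWord (u ++ [true]) := by
  rw [dfsWord_lt_append_true_iff]
  constructor
  · intro hlt
    by_contra! hle
    exact (freeCount_mono hle.le).not_gt hlt
  · intro hle
    have hlt : dfsWord v < dfsWord u := hle.lt_of_ne fun he => by
      rw [dfsWord_injective he] at h; omega
    exact (freeCount_mono hle).lt_of_ne fun he => by
      have := rhoDot_lt_of_freeCount_eq hu hlt he
      omega

theorem freeCount_eq_iff {u v : List Bool} (hu : T.IsNode u) (hv : T.IsNode v)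
    (h : rhoDot v = rhoDot u + 1) :
    T.freeCount v = T.freeCount u ↔ v = u ++ [true] ∧ T.IsCaptive (u ++ [true]) := by
  constructor
  · intro he
    rcases lt_trichotomy (dfsWord u) (dfsWord v) with hlt | heq | hlt
    · obtain ⟨x, rfl, hc, hle, hx, hxn⟩ := exists_of_freeCount_eq hv hlt he.symm
      have hr : rhoDot (x ++ [true]) = rhoDot x + 1 := by simp
      rcases hle.lt_or_eq with hl | hl
      · have := rhoDot_lt_of_freeCount_eq hxn hl hx
        omega
      · rw [dfsWord_injective hl]; exact ⟨rfl, hc⟩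
    · rw [dfsWord_injective heq] at h; omega
    · have := rhoDot_lt_of_freeCount_eq hu hlt he
      omega
  · rintro ⟨rfl, hc⟩
    exact freeCount_append_true hc

variable (T)

/-- The height of a vertex, an integer multiple of the coordinate of a point. -/
noncomputable def height (v : List Bool) : ℕ := (T.numFree + 1) * rhoDot v + T.freeCount v

/-- A point of the Catalan face. -/
noncomputable def catalanPoint (i : Fin n) : ℝ := T.height (T.nodeOf i) / (T.numFree + 1)

variable {T}

/-- Comparison of two-digit numbers in base `N + 1`. -/
theorem mul_add_lt_iff {N a b x y : ℕ} (hx : x ≤ N) (hy : y ≤ N) :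
    (N + 1) * a + x < (N + 1) * b + y ↔ a < b ∨ a = b ∧ x < y := by
  rcases lt_trichotomy a b with h | rfl | h
  · simp only [h, true_or, iff_true]; nlinarith
  · simp
  · simp only [h.not_gt, h.ne', false_and, or_self, iff_false, not_lt]; nlinarith

theorem height_lt_iff {u v : List Bool} (hv : T.IsNode v) :
    T.height u < T.height v ↔ vertexKey u < vertexKey v := by
  rw [height, height, mul_add_lt_iff (T.freeCount_le u) (T.freeCount_le v), vertexKey_lt_iff]
  exact or_congr_right (and_congr_right (freeCount_lt_iff hv))

theorem height_lt_add_iff {u v : List Bool} (hu : T.IsNode u) :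
    T.height v < T.height u + (T.numFree + 1) ↔ vertexKey v < vertexKey (u ++ [true]) := by
  have : T.height u + (T.numFree + 1) = (T.numFree + 1) * (rhoDot u + 1) + T.freeCount u := by
    rw [height]; ring
  rw [this, height, mul_add_lt_iff (T.freeCount_le v) (T.freeCount_le u), vertexKey_lt_iff]
  have hr : rhoDot (u ++ [true]) = rhoDot u + 1 := by simp
  rw [hr]
  exact or_congr_right (and_congr_right (freeCount_lt_iff_append_true hu))

theorem height_eq_add_iff {u v : List Bool} (hu : T.IsNode u) (hv : T.IsNode v) :
    T.height v = T.height u + (T.numFree + 1) ↔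
      v = u ++ [true] ∧ T.IsCaptive (u ++ [true]) := by
  have : T.height u + (T.numFree + 1) = (T.numFree + 1) * (rhoDot u + 1) + T.freeCount u := by
    rw [height]; ring
  constructor
  · intro he
    have h1 := mul_add_lt_iff (a := rhoDot v) (b := rhoDot u + 1)
      (T.freeCount_le v) (T.freeCount_le u)
    have h2 := mul_add_lt_iff (a := rhoDot u + 1) (b := rhoDot v)
      (T.freeCount_le u) (T.freeCount_le v)
    rw [this, height] at he
    simp only [he, lt_irrefl, false_iff] at h1 h2
    have hr : rhoDot v = rhoDot u + 1 := by omega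
    exact (freeCount_eq_iff hu hv hr).1 (by omega)
  · rintro ⟨rfl, hc⟩
    rw [this, height, freeCount_append_true hc]
    simp

theorem catalanPoint_le_iff (i j : Fin n) :
    T.catalanPoint i ≤ T.catalanPoint j ↔ T.height (T.nodeOf i) ≤ T.height (T.nodeOf j) := by
  rw [catalanPoint, catalanPoint, div_le_div_iff_of_pos_right (by positivity), Nat.cast_le]

theorem catalanPoint_add_one (i : Fin n) :
    T.catalanPoint i + 1 =
      ((T.height (T.nodeOf i) + (T.numFree + 1) : ℕ) : ℝ) / (T.numFree + 1) := by
  rw [catalanPoint]; push_cast; field_simp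

theorem catalanConditions_catalanPoint : T.CatalanConditions T.catalanPoint := by
  refine ⟨fun i j => ?_, fun i j => ?_, fun i j => ?_⟩
  · rw [catalanPoint_le_iff, vertexLE_iff, ← not_lt, height_lt_iff (isNode_nodeOf i), not_lt]
  · rw [catalanPoint_add_one, catalanPoint, div_lt_div_iff_of_pos_right (by positivity),
      Nat.cast_lt, height_lt_add_iff (isNode_nodeOf j), vertexLT_iff, rightChildOf]
  · rw [catalanPoint_add_one, catalanPoint, div_left_inj' (by positivity), Nat.cast_inj,
      height_eq_add_iff (isNode_nodeOf j) (isNode_nodeOf i), rightChildOf]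

theorem CatalanConditions.shiConditions {p : Fin n → ℝ} (h : T.CatalanConditions p) :
    T.ShiConditions p :=
  ⟨h.1, fun i j _ => h.2.1 i j, fun i j _ => h.2.2 i j⟩

end DecoratedBinaryTree

/-! ### Faces -/

theorem sign_eq_sign_iff {a b : ℝ} :
    SignType.sign a = SignType.sign b ↔ (a < 0 ↔ b < 0) ∧ (a = 0 ↔ b = 0) := by
  rcases lt_trichotomy a 0 with ha | rfl | ha <;> rcases lt_trichotomy b 0 with hb | rfl | hb <;>
    simp [*, sign_neg, sign_pos, ne_of_lt, ne_of_gt, not_lt_of_gt]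

/-- Serves both arrangements: `r` is `<` for Shi and `≠` for Catalan. Hyperplanes through the origin
with `i < j` already decide the whole weak order. -/
theorem forall_sign_eq_iff {n : ℕ} {r : Fin n → Fin n → Prop} (hr : ∀ i j, i < j → r i j)
    (p q : Fin n → ℝ) :
    (∀ h : Fin n × Fin n × ℝ, r h.1 h.2.1 ∧ (h.2.2 = 0 ∨ h.2.2 = 1) →
      SignType.sign (p h.1 - p h.2.1 - h.2.2) = SignType.sign (q h.1 - q h.2.1 - h.2.2)) ↔
    (∀ i j, p i ≤ p j ↔ q i ≤ q j) ∧ (∀ i j, r i j → (p i < p j + 1 ↔ q i < q j + 1)) ∧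
      (∀ i j, r i j → (p i = p j + 1 ↔ q i = q j + 1)) := by
  have h0 : ∀ (x : Fin n → ℝ) i j, (x i - x j - 0 < 0 ↔ x i < x j) ∧
      (x i - x j - 0 = 0 ↔ x i = x j) := fun x i j => by
    rw [sub_zero, sub_neg, sub_eq_zero]; simp
  have h1 : ∀ (x : Fin n → ℝ) i j, (x i - x j - 1 < 0 ↔ x i < x j + 1) ∧
      (x i - x j - 1 = 0 ↔ x i = x j + 1) := fun x i j => by
    constructor <;> constructor <;> intro h <;> linarith
  constructor
  · intro h
    have H1 : ∀ i j, r i j → (p i < p j + 1 ↔ q i < q j + 1) ∧ (p i = p j + 1 ↔ q i = q j + 1) :=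
      fun i j hij => by
        have := h (i, j, 1) ⟨hij, Or.inr rfl⟩
        simpa only [sign_eq_sign_iff, h1] using this
    have H0 : ∀ i j, i < j → (p i < p j ↔ q i < q j) ∧ (p i = p j ↔ q i = q j) :=
      fun i j hij => by
        have := h (i, j, 0) ⟨hr i j hij, Or.inl rfl⟩
        simpa only [sign_eq_sign_iff, h0] using this
    refine ⟨fun i j => ?_, fun i j hij => (H1 i j hij).1, fun i j hij => (H1 i j hij).2⟩
    rcases lt_trichotomy i j with hij | rfl | hij
    · rw [le_iff_lt_or_eq, le_iff_lt_or_eq, (H0 i j hij).1, (H0 i j hij).2]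
    · simp
    · rw [← not_lt, ← not_lt, (H0 j i hij).1]
  · rintro ⟨h, h', h''⟩ ⟨i, j, s⟩ ⟨hij, hs⟩
    dsimp only at hij hs ⊢
    rw [sign_eq_sign_iff]
    rcases hs with rfl | rfl
    · simp only [h0, ← not_le, le_antisymm_iff, h, and_self]
    · simp only [h1, h' i j hij, h'' i j hij, and_self]

theorem IsFace.eq_of_mem {n : ℕ} {A : Set (Fin n × Fin n × ℝ)} {F G : Set (Fin n → ℝ)}
    (hF : IsFace A F) (hG : IsFace A G) {p : Fin n → ℝ} (hpF : p ∈ F) (hpG : p ∈ G) : F = G := by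
  obtain ⟨-, δ, rfl⟩ := hF
  obtain ⟨-, ε, rfl⟩ := hG
  ext x
  refine forall₂_congr fun h hh => ?_
  rw [← hpF h hh, ← hpG h hh]

namespace DecoratedBinaryTree

variable {n : ℕ} {T : DecoratedBinaryTree n}

theorem ShiConditions.iff_sign {p : Fin n → ℝ} (hp : T.ShiConditions p) (x : Fin n → ℝ) :
    T.ShiConditions x ↔ ∀ h ∈ shiArrangement n,
      SignType.sign (x h.1 - x h.2.1 - h.2.2) = SignType.sign (p h.1 - p h.2.1 - h.2.2) := by
  refine Iff.trans ?_ (forall_sign_eq_iff (r := (· < ·)) (fun _ _ h => h) x p).symm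
  refine and_congr ?_ (and_congr ?_ ?_)
  · simp only [hp.1]
  · exact forall₃_congr fun i j hij => by rw [hp.2.1 i j hij]
  · exact forall₃_congr fun i j hij => by rw [hp.2.2 i j hij]

theorem CatalanConditions.iff_sign {p : Fin n → ℝ} (hp : T.CatalanConditions p)
    (x : Fin n → ℝ) : T.CatalanConditions x ↔ ∀ h ∈ catalanArrangement n,
      SignType.sign (x h.1 - x h.2.1 - h.2.2) = SignType.sign (p h.1 - p h.2.1 - h.2.2) := by
  refine Iff.trans ?_ (forall_sign_eq_iff (r := (· ≠ ·)) (fun _ _ h => h.ne) x p).symm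
  refine and_congr ?_ (and_congr ?_ ?_)
  · simp only [hp.1]
  · refine forall₂_congr fun i j => ?_
    rw [← hp.2.1 i j]
    rcases eq_or_ne i j with rfl | hij <;> simp [*]
  · refine forall₂_congr fun i j => ?_
    rw [← hp.2.2 i j]
    rcases eq_or_ne i j with rfl | hij <;> simp [*]

variable (T)

theorem isFace_setOf_shiConditions : IsFace (shiArrangement n) {p | T.ShiConditions p} :=
  have h := T.catalanConditions_catalanPoint.shiConditions
  ⟨⟨_, h⟩, _, Set.ext h.iff_sign⟩

theorem isFace_setOf_catalanConditions :
    IsFace (catalanArrangement n) {p | T.CatalanConditions p} :=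
  have h := T.catalanConditions_catalanPoint
  ⟨⟨_, h⟩, _, Set.ext h.iff_sign⟩

/-! ### The dimension of a Shi face -/

open Classical in
/-- The free node reached from `v` by going up along dashed edges. -/
noncomputable def freeRoot (v : List Bool) : List Bool :=
  -- A captive node is never the root; `v ≠ []` is there for termination.
  if _ : T.IsCaptive v ∧ v ≠ [] then freeRoot v.dropLast else v
termination_by v.length
decreasing_by simp; have := List.length_pos_iff.2 ‹T.IsCaptive v ∧ v ≠ []›.2; omega

variable {T}

theorem freeRoot_append_true {u : List Bool} (h : T.IsCaptive (u ++ [true])) :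
    T.freeRoot (u ++ [true]) = T.freeRoot u := by
  rw [freeRoot, dif_pos ⟨h, by simp⟩, List.dropLast_concat]

theorem freeRoot_of_not_isCaptive {v : List Bool} (h : ¬ T.IsCaptive v) : T.freeRoot v = v := by
  rw [freeRoot, dif_neg fun h' => h h'.1]

theorem IsNode.captive_induction {P : ∀ v, T.IsNode v → Prop}
    (free : ∀ v (hv : T.IsFree v), P v hv.1)
    (captive : ∀ v (hv : T.IsNode v) (hc : T.IsCaptive (v ++ [true])), P v hv →
      P (v ++ [true]) hc.1)
    {v : List Bool} (hv : T.IsNode v) : P v hv := by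
  induction v using List.reverseRecOn with
  | nil => exact free _ ⟨hv, fun h => by obtain ⟨u, hu, -⟩ := h.exists_eq; simp at hu⟩
  | append_singleton v b ih =>
    by_cases h : T.IsCaptive (v ++ [b])
    · obtain ⟨u, hu, -⟩ := h.exists_eq
      obtain ⟨rfl, hb⟩ := List.append_inj' hu rfl
      obtain rfl : b = true := by simpa using hb
      exact captive v hv.of_append h (ih hv.of_append)
    · exact free _ ⟨hv, h⟩

theorem isFree_freeRoot {v : List Bool} (hv : T.IsNode v) : T.IsFree (T.freeRoot v) := by
  induction hv using IsNode.captive_induction with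
  | free v hv => rwa [freeRoot_of_not_isCaptive hv.2]
  | captive v _ hc ih => rwa [freeRoot_append_true hc]

/-- Climbing a dashed edge lowers both `p` and `q` by exactly 1. The Shi conditions give this only
for a pair `a < b`, which the descent on the edge supplies. -/
theorem IsShiType.sub_eq_sub (hT : T.IsShiType) {p q : Fin n → ℝ} (hp : T.ShiConditions p)
    (hq : T.ShiConditions q) {i j : Fin n} (h : T.freeRoot (T.nodeOf i) = T.nodeOf j) :
    p i - q i = p j - q j := by
  have eq : ∀ {x : Fin n → ℝ}, T.ShiConditions x → ∀ {i j}, T.nodeOf i = T.nodeOf j →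
      x i = x j := fun {x} hx {i j} hij =>
    le_antisymm ((hx.1 i j).2 (Or.inr hij)) ((hx.1 j i).2 (Or.inr hij.symm))
  generalize hv : T.nodeOf i = v at h
  have hvn : T.IsNode v := hv ▸ isNode_nodeOf i
  induction hvn using IsNode.captive_induction generalizing i with
  | free v hf =>
    rw [freeRoot_of_not_isCaptive hf.2] at h
    rw [eq hp (hv.trans h), eq hq (hv.trans h)]
  | captive v hvn hc ih =>
    rw [freeRoot_append_true hc] at h
    obtain ⟨a, b, hab, ha, hb⟩ := hT.exists_lt (hv ▸ isNode_nodeOf i)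
    have hr : T.nodeOf a = T.rightChildOf b ∧ T.IsCaptive (T.rightChildOf b) := by
      rw [rightChildOf, hb]; exact ⟨ha, hc⟩
    have h1 := (hp.2.2 a b hab).2 hr
    have h2 := (hq.2.2 a b hab).2 hr
    rw [eq hp (hv.trans ha.symm), eq hq (hv.trans ha.symm), ← ih hb h, h1, h2]
    ring

theorem eventually_sign_add_mul_eq {a b : ℝ} (h : a = 0 → b = 0) :
    ∀ᶠ ε : ℝ in nhds 0, SignType.sign (a + ε * b) = SignType.sign a := by
  have ht : Filter.Tendsto (fun ε : ℝ => a + ε * b) (nhds 0) (nhds a) := by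
    have : Continuous fun ε : ℝ => a + ε * b := by fun_prop
    simpa using this.tendsto 0
  rcases lt_trichotomy a 0 with ha | ha | ha
  · filter_upwards [ht.eventually_lt_const ha] with ε hε
    rw [sign_neg hε, sign_neg ha]
  · simp [h ha]
  · filter_upwards [ht.eventually_const_lt ha] with ε hε
    rw [sign_pos hε, sign_pos ha]

/-- Strict inequalities survive small perturbations. Each equality at `p` comes from a shared node
or a dashed edge, where `w` is constant. -/
theorem CatalanConditions.eventually_shiConditions {p w : Fin n → ℝ} (hp : T.CatalanConditions p)
    (hw : ∀ i j, T.freeRoot (T.nodeOf i) = T.freeRoot (T.nodeOf j) → w i = w j) :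
    ∀ᶠ ε : ℝ in nhds 0, T.ShiConditions (p + ε • w) := by
  have key : ∀ i j : Fin n, ∀ s : ℝ, s = 0 ∨ s = 1 → ∀ᶠ ε : ℝ in nhds 0,
      SignType.sign ((p i - p j - s) + ε * (w i - w j)) = SignType.sign (p i - p j - s) := by
    intro i j s hs
    refine eventually_sign_add_mul_eq fun h => sub_eq_zero.2 (hw i j ?_)
    rcases hs with rfl | rfl
    · have h : p i = p j := by linarith
      have h1 := vertexLE_iff.1 ((hp.1 i j).1 h.le)
      have h2 := vertexLE_iff.1 ((hp.1 j i).1 h.ge)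
      rw [vertexKey_injective (h1.antisymm h2)]
    · obtain ⟨h, hc⟩ := (hp.2.2 i j).1 (by linarith)
      rw [h, rightChildOf, freeRoot_append_true hc]
  have h0 := Filter.eventually_all.2 fun i => Filter.eventually_all.2 fun j =>
    key i j 0 (Or.inl rfl)
  have h1 := Filter.eventually_all.2 fun i => Filter.eventually_all.2 fun j =>
    key i j 1 (Or.inr rfl)
  filter_upwards [h0, h1] with ε h0 h1
  rw [hp.shiConditions.iff_sign]
  rintro ⟨i, j, s⟩ ⟨-, hs⟩
  have e : (p + ε • w) i - (p + ε • w) j - s = (p i - p j - s) + ε * (w i - w j) := by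
    simp only [Pi.add_apply, Pi.smul_apply, smul_eq_mul]; ring
  dsimp only at hs ⊢
  rw [e]
  rcases hs with rfl | rfl
  · exact h0 i j
  · exact h1 i j

theorem IsShiType.affineDim_eq (hT : T.IsShiType) :
    affineDim {p | T.ShiConditions p} = T.numFree := by
  let g : Fin n → {v | T.IsFree v} := fun i => ⟨T.freeRoot (T.nodeOf i),
    isFree_freeRoot (isNode_nodeOf i)⟩
  have hg : Function.Surjective g := by
    rintro ⟨v, hv⟩
    obtain ⟨i, rfl⟩ := hv.1.exists_nodeOf_eq
    exact ⟨i, Subtype.ext (freeRoot_of_not_isCaptive hv.2)⟩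
  have hdir : (affineSpan ℝ {p | T.ShiConditions p}).direction =
      LinearMap.range (LinearMap.funLeft ℝ ℝ g) := by
    apply le_antisymm
    · rw [direction_affineSpan, vectorSpan_def, Submodule.span_le]
      rintro _ ⟨p, hp, q, hq, rfl⟩
      -- Choose an index in the label of each free node; the difference `p - q` is read off at these
      -- representatives.
      choose s hs using fun v : {v | T.IsFree v} => v.2.1.exists_nodeOf_eq
      refine ⟨fun v => p (s v) - q (s v), funext fun i => ?_⟩
      exact (hT.sub_eq_sub hp hq (hs (g i)).symm).symm
    · rintro _ ⟨f, rfl⟩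
      have hp := T.catalanConditions_catalanPoint
      obtain ⟨ε, hε, hs⟩ := ((hp.eventually_shiConditions (w := LinearMap.funLeft ℝ ℝ g f)
        fun i j hij => congrArg f (Subtype.ext hij)).filter_mono
          nhdsWithin_le_nhds).and (self_mem_nhdsWithin (s := Set.Ioi (0 : ℝ))) |>.exists
      have := AffineSubspace.vsub_mem_direction
        (mem_affineSpan ℝ (show _ ∈ {p | T.ShiConditions p} from hε))
        (mem_affineSpan ℝ (show _ ∈ {p | T.ShiConditions p} from hp.shiConditions))
      rw [vsub_eq_sub, add_sub_cancel_left] at this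
      exact (Submodule.smul_mem_iff _ (ne_of_gt hs)).1 this
  have : Fintype {v | T.IsFree v} := T.finite_isFree.fintype
  rw [affineDim, hdir, LinearMap.finrank_range_of_inj (LinearMap.funLeft_injective_of_surjective
    ℝ ℝ g hg), Module.finrank_fintype_fun_eq_card, numFree, Set.ncard_eq_toFinset_card',
    Set.toFinset_card]

end DecoratedBinaryTree

namespace DecoratedBinaryTree

variable {n : ℕ} {T T' : DecoratedBinaryTree n}

/-! ### Recovering a tree from its Shi face -/

theorem ShiConditions.le_iff {p : Fin n → ℝ} (hp : T.ShiConditions p) (i j : Fin n) :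
    p i ≤ p j ↔ vertexKey (T.nodeOf i) ≤ vertexKey (T.nodeOf j) := by
  rw [hp.1, vertexLE_iff]

theorem ShiConditions.add_one_le_iff {p : Fin n → ℝ} (hp : T.ShiConditions p) {i j : Fin n}
    (h : i < j) :
    p j + 1 ≤ p i ↔ vertexKey (T.nodeOf j ++ [true]) ≤ vertexKey (T.nodeOf i) := by
  rw [← not_lt, hp.2.1 i j h, vertexLT_iff, not_lt, rightChildOf]

theorem ShiConditions.eq_iff {p : Fin n → ℝ} (hp : T.ShiConditions p) {i j : Fin n} :
    p i = p j ↔ T.nodeOf i = T.nodeOf j := by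
  rw [le_antisymm_iff, hp.le_iff, hp.le_iff, ← le_antisymm_iff, vertexKey_injective.eq_iff]

/-- For a tree of Shi type, the comparison of right children with nodes is determined by the
Shi face. -/
theorem IsShiType.append_true_le_iff (hT : T.IsShiType) {p : Fin n → ℝ}
    (hp : T.ShiConditions p) (i j : Fin n) :
    vertexKey (T.nodeOf j ++ [true]) ≤ vertexKey (T.nodeOf i) ↔
      ∃ a b, a < b ∧ p b + 1 ≤ p a ∧ p a ≤ p i ∧ p j ≤ p b := by
  constructor
  · intro h
    have hpos : 0 < rhoDot (T.nodeOf i) := by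
      by_contra! h0
      refine h.not_gt (vertexKey_lt_iff.2 (Or.inl ?_))
      simp; omega
    -- The last right edge on the path to `i` goes from `u` to `u ++ [true]`; its descent provides
    -- `a` and `b`.
    obtain ⟨u, t, hu⟩ := exists_eq_append_true_replicate hpos
    have hn : T.IsNode (u ++ [true]) := by
      refine IsNode.of_append (w := List.replicate t false) ?_
      simpa [hu] using isNode_nodeOf (T := T) i
    obtain ⟨a, b, hab, ha, hb⟩ := hT.exists_lt hn
    rw [hu, vertexKey_append_true_le_append_iff] at h
    refine ⟨a, b, hab, ?_, ?_, ?_⟩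
    · rw [hp.add_one_le_iff hab, ha, hb]
    · rw [hp.le_iff, ha, hu, vertexKey_append_true_le_append_iff]
    · rwa [hp.le_iff, hb]
  · rintro ⟨a, b, hab, h, hai, hjb⟩
    rw [hp.add_one_le_iff hab] at h
    rw [hp.le_iff] at hai hjb
    exact ((vertexKey_append_true_le_iff.2 hjb).trans h).trans hai

theorem IsShiType.isCaptive_iff (hT : T.IsShiType) {p : Fin n → ℝ}
    (hp : T.ShiConditions p) (j : Fin n) :
    T.IsCaptive (T.nodeOf j ++ [true]) ↔ ∃ a b, a < b ∧ p a = p b + 1 ∧ p b = p j := by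
  constructor
  · intro h
    obtain ⟨a, b, hab, ha, hb⟩ := hT.exists_lt h.1
    refine ⟨a, b, hab, (hp.2.2 a b hab).2 ?_, hp.eq_iff.2 hb⟩
    rw [rightChildOf, hb]
    exact ⟨ha, h⟩
  · rintro ⟨a, b, hab, h, hbj⟩
    rw [← hp.eq_iff.1 hbj]
    exact ((hp.2.2 a b hab).1 h).2

/-- In `T'`, let `k` be the parent in the last right edge on the path to `i`. Comparing right
children in both trees gives `j ⪯ k` and `k ⪯ j`, so the right child of `j` is a node of `T'`. In
`T` the node of `i` is the least one weakly above that right child, and this transfers to `T'`. -/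
theorem nodeOf_eq_append_true
    (hle : ∀ i j, vertexKey (T.nodeOf i) ≤ vertexKey (T.nodeOf j) ↔
      vertexKey (T'.nodeOf i) ≤ vertexKey (T'.nodeOf j))
    (hR : ∀ i j, vertexKey (T.nodeOf j ++ [true]) ≤ vertexKey (T.nodeOf i) ↔
      vertexKey (T'.nodeOf j ++ [true]) ≤ vertexKey (T'.nodeOf i))
    {i j : Fin n} (h : T.nodeOf i = T.nodeOf j ++ [true]) :
    T'.nodeOf i = T'.nodeOf j ++ [true] := by
  have h1 : vertexKey (T'.nodeOf j ++ [true]) ≤ vertexKey (T'.nodeOf i) := (hR i j).1 (by rw [h])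
  have hpos : 0 < rhoDot (T'.nodeOf i) := by
    by_contra! h0
    refine h1.not_gt (vertexKey_lt_iff.2 (Or.inl ?_))
    simp; omega
  obtain ⟨u, t, hu⟩ := exists_eq_append_true_replicate hpos
  have hin := isNode_nodeOf (T := T') i
  rw [hu] at hin
  obtain ⟨k, rfl⟩ := (IsNode.of_append hin).exists_nodeOf_eq
  rw [hu, vertexKey_append_true_le_append_iff] at h1
  have h2 : vertexKey (T'.nodeOf k ++ [true]) ≤ vertexKey (T'.nodeOf i) := by
    rw [hu, vertexKey_append_true_le_append_iff]
  rw [← hR, h, vertexKey_append_true_le_iff, hle] at h2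
  rw [vertexKey_injective (h2.antisymm h1)] at hu hin
  have hn : T'.IsNode (T'.nodeOf j ++ [true]) := by
    refine IsNode.of_append (w := List.replicate t false) ?_
    simpa using hin
  obtain ⟨a, ha⟩ := hn.exists_nodeOf_eq
  have h3 : vertexKey (T.nodeOf i) ≤ vertexKey (T.nodeOf a) := by
    rw [h, hR, ha]
  rw [hle, ha] at h3
  refine vertexKey_injective (h3.antisymm ?_)
  rw [hu, vertexKey_append_true_le_append_iff]

/-- By the previous lemma with the trees exchanged, `i` is not a right child in `T'`. It is thus the
left child of some `k`, and left children being immediate successors forces `k` and `j` to share a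
node. -/
theorem nodeOf_eq_append_false
    (hle : ∀ i j, vertexKey (T.nodeOf i) ≤ vertexKey (T.nodeOf j) ↔
      vertexKey (T'.nodeOf i) ≤ vertexKey (T'.nodeOf j))
    (hR : ∀ i j, vertexKey (T.nodeOf j ++ [true]) ≤ vertexKey (T.nodeOf i) ↔
      vertexKey (T'.nodeOf j ++ [true]) ≤ vertexKey (T'.nodeOf i))
    {i j : Fin n} (h : T.nodeOf i = T.nodeOf j ++ [false]) :
    T'.nodeOf i = T'.nodeOf j ++ [false] := by
  have hlt : ∀ i j, vertexKey (T.nodeOf i) < vertexKey (T.nodeOf j) ↔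
      vertexKey (T'.nodeOf i) < vertexKey (T'.nodeOf j) := fun i j => by
    rw [← not_le, hle, not_le]
  have h1 : vertexKey (T'.nodeOf j) < vertexKey (T'.nodeOf i) :=
    (hlt j i).1 (h ▸ vertexKey_lt_append_false _)
  rcases List.eq_nil_or_concat' (T'.nodeOf i) with h0 | ⟨u, b, hu⟩
  · rw [h0] at h1
    exact absurd h1 (vertexKey_nil_le _).not_gt
  · have hin := isNode_nodeOf (T := T') i
    rw [hu] at hin
    obtain ⟨k, rfl⟩ := hin.of_append.exists_nodeOf_eq
    cases b with
    | true =>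
      have := nodeOf_eq_append_true (fun i j => (hle i j).symm) (fun i j => (hR i j).symm) hu
      rw [h] at this
      simpa using (List.append_inj' this rfl).2
    | false =>
      rw [hu]
      have h2 : vertexKey (T'.nodeOf k) < vertexKey (T'.nodeOf i) :=
        hu ▸ vertexKey_lt_append_false _
      rcases lt_trichotomy (vertexKey (T'.nodeOf j)) (vertexKey (T'.nodeOf k)) with h3 | h3 | h3
      · rw [← hlt, ← vertexKey_append_false_le_iff, ← h, hle] at h3
        exact absurd h3 h2.not_ge
      · rw [vertexKey_injective h3]
      · rw [← vertexKey_append_false_le_iff, ← hu] at h3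
        exact absurd h3 h1.not_ge

theorem nodeOf_congr
    (hle : ∀ i j, vertexKey (T.nodeOf i) ≤ vertexKey (T.nodeOf j) ↔
      vertexKey (T'.nodeOf i) ≤ vertexKey (T'.nodeOf j))
    (hR : ∀ i j, vertexKey (T.nodeOf j ++ [true]) ≤ vertexKey (T.nodeOf i) ↔
      vertexKey (T'.nodeOf j ++ [true]) ≤ vertexKey (T'.nodeOf i)) (i : Fin n) :
    T'.nodeOf i = T.nodeOf i := by
  generalize hv : T.nodeOf i = v
  induction v using List.reverseRecOn generalizing i with
  | nil =>
    have hn : T'.IsNode [] := IsNode.of_append (w := T'.nodeOf i) (isNode_nodeOf i)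
    obtain ⟨k, hk⟩ := hn.exists_nodeOf_eq
    have h : vertexKey (T.nodeOf i) ≤ vertexKey (T.nodeOf k) := hv ▸ vertexKey_nil_le _
    rw [hle, hk] at h
    exact vertexKey_injective (h.antisymm (vertexKey_nil_le _))
  | append_singleton v b ih =>
    have hin := isNode_nodeOf (T := T) i
    rw [hv] at hin
    obtain ⟨j, rfl⟩ := hin.of_append.exists_nodeOf_eq
    rw [← ih j rfl]
    cases b with
    | true => exact nodeOf_eq_append_true hle hR hv
    | false => exact nodeOf_eq_append_false hle hR hv

theorem eq_of_nodeOf_eq (h : ∀ i, T'.nodeOf i = T.nodeOf i)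
    (hc : ∀ i, T.IsCaptive (T.nodeOf i ++ [true]) ↔ T'.IsCaptive (T.nodeOf i ++ [true])) :
    T = T' := by
  refine DecoratedBinaryTree.ext (BinaryTree.ext_valueAt fun v => ?_)
  have hn : T.IsNode v ↔ T'.IsNode v := by
    constructor <;> intro hv <;> obtain ⟨i, rfl⟩ := hv.exists_nodeOf_eq
    · rw [← h]; exact isNode_nodeOf i
    · rw [h]; exact isNode_nodeOf i
  cases hd : T.tree.valueAt v with
  | none =>
    cases he : T'.tree.valueAt v with
    | none => rfl
    | some e =>
      obtain ⟨d, hd'⟩ := hn.2 ⟨e, he⟩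
      simp [hd] at hd'
  | some d =>
    obtain ⟨e, he⟩ := hn.1 ⟨d, hd⟩
    rw [he, Option.some_inj]
    refine NodeDecoration.ext ?_ ?_
    · ext i
      rw [mem_label_iff hd, mem_label_iff he, h]
    · obtain ⟨i, rfl⟩ := IsNode.exists_nodeOf_eq (T := T) ⟨d, hd⟩
      rw [Bool.eq_iff_iff, ← isCaptive_append_true_iff hd, ← isCaptive_append_true_iff he, hc]

theorem IsShiType.eq_of_shiConditions (hT : T.IsShiType) (hT' : T'.IsShiType) {p : Fin n → ℝ}
    (hp : T.ShiConditions p) (hp' : T'.ShiConditions p) : T = T' := by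
  have h := nodeOf_congr (T := T) (T' := T')
    (fun i j => by rw [← hp.le_iff, ← hp'.le_iff])
    (fun i j => by rw [hT.append_true_le_iff hp, hT'.append_true_le_iff hp'])
  refine eq_of_nodeOf_eq h fun i => ?_
  rw [hT.isCaptive_iff hp, ← h, hT'.isCaptive_iff hp']

end DecoratedBinaryTree

/-! ### The tree of a point -/

/-- The address of the `k`-th node of a tree in which exactly the right children of the first
`r k` nodes come weakly before the `k`-th node. -/
def nodeAddress (r : ℕ → ℕ) (k : ℕ) : List Bool :=
  match k with
  | 0 => []
  | k + 1 =>
    if r (k + 1) = r k then nodeAddress r k ++ [false]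
    -- When `r (k + 1) ≤ k + 1` the minimum is just `r (k + 1) - 1`; it ensures termination for
    -- arbitrary `r`.
    else nodeAddress r (min k (r (k + 1) - 1)) ++ [true]
termination_by k
decreasing_by all_goals omega

section NodeAddress

variable {r : ℕ → ℕ}

theorem nodeAddress_zero (r : ℕ → ℕ) : nodeAddress r 0 = [] := by rw [nodeAddress]

theorem nodeAddress_succ_of_eq {k : ℕ} (h : r (k + 1) = r k) :
    nodeAddress r (k + 1) = nodeAddress r k ++ [false] := by
  rw [nodeAddress, if_pos h]

theorem nodeAddress_succ_of_ne (hle : ∀ k, r k ≤ k) {k s : ℕ} (h : r (k + 1) ≠ r k) (hs : r (k + 1) = s + 1) :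
    nodeAddress r (k + 1) = nodeAddress r s ++ [true] := by
  have : min k (r (k + 1) - 1) = s := by have := hle (k + 1); omega
  rw [nodeAddress, if_neg h, this]

theorem nodeAddress_of_eq_zero (hr : Monotone r) {k : ℕ} (h : r k = 0) :
    nodeAddress r k = List.replicate k false := by
  induction k with
  | zero => exact nodeAddress_zero r
  | succ k ih =>
    have hk : r k = 0 := Nat.le_zero.1 (h ▸ hr k.le_succ)
    rw [nodeAddress_succ_of_eq (h.trans hk.symm), ih hk, List.replicate_succ']

/-- Since `r` last changed, only left steps have been taken. -/
theorem exists_nodeAddress_eq (hle : ∀ k, r k ≤ k) {k s : ℕ} (h : r k = s + 1) :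
    ∃ t, nodeAddress r k = nodeAddress r s ++ true :: List.replicate t false := by
  induction k with
  | zero => have := hle 0; omega
  | succ k ih =>
    by_cases hk : r (k + 1) = r k
    · obtain ⟨t, ht⟩ := ih (hk ▸ h)
      exact ⟨t + 1, by rw [nodeAddress_succ_of_eq hk, ht, List.replicate_succ']; simp⟩
    · exact ⟨0, nodeAddress_succ_of_ne hle hk h⟩

/-- A left step moves to the immediate successor. When `r` jumps from `s' + 1` to `s + 1`, the old
node hangs from the right child of node `s'` by left edges, and `s' < s` carries over to the right
children. -/
theorem vertexKey_nodeAddress_lt (hr : Monotone r) (hle : ∀ k, r k ≤ k) {j k : ℕ} (h : j < k) :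
    vertexKey (nodeAddress r j) < vertexKey (nodeAddress r k) := by
  induction k using Nat.strong_induction_on generalizing j with
  | _ k ih =>
    obtain ⟨k, rfl⟩ : ∃ l, k = l + 1 := ⟨k - 1, by omega⟩
    suffices hs : vertexKey (nodeAddress r k) < vertexKey (nodeAddress r (k + 1)) by
      rcases (Nat.lt_succ_iff.1 h).lt_or_eq with hj | rfl
      · exact (ih k k.lt_succ_self hj).trans hs
      · exact hs
    by_cases hk : r (k + 1) = r k
    · rw [nodeAddress_succ_of_eq hk]
      exact vertexKey_lt_append_false _
    · have hlt : r k < r (k + 1) := (hr k.le_succ).lt_of_ne (Ne.symm hk)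
      obtain ⟨s, hs⟩ : ∃ s, r (k + 1) = s + 1 := ⟨r (k + 1) - 1, by omega⟩
      rw [nodeAddress_succ_of_ne hle hk hs]
      rcases Nat.eq_zero_or_pos (r k) with h0 | h0
      · rw [nodeAddress_of_eq_zero hr h0, vertexKey_lt_iff]
        left; simp
      · obtain ⟨s', hs'⟩ : ∃ s', r k = s' + 1 := ⟨r k - 1, by omega⟩
        obtain ⟨t, ht⟩ := exists_nodeAddress_eq hle hs'
        rw [ht]
        have := hle (k + 1)
        exact vertexKey_append_true_lt (ih s (by omega) (by omega)) t 0

theorem vertexKey_nodeAddress_strictMono (hr : Monotone r) (hle : ∀ k, r k ≤ k) :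
    StrictMono fun k => vertexKey (nodeAddress r k) :=
  fun _ _ h => vertexKey_nodeAddress_lt hr hle h

theorem nodeAddress_injective (hr : Monotone r) (hle : ∀ k, r k ≤ k) :
    Function.Injective (nodeAddress r) :=
  fun _ _ h => (vertexKey_nodeAddress_strictMono hr hle).injective (congrArg vertexKey h)

theorem nodeAddress_append_true_le_iff (hr : Monotone r) (hle : ∀ k, r k ≤ k) {j k : ℕ} :
    vertexKey (nodeAddress r j ++ [true]) ≤ vertexKey (nodeAddress r k) ↔ j < r k := by
  rcases Nat.eq_zero_or_pos (r k) with h0 | h0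
  · rw [nodeAddress_of_eq_zero hr h0, h0]
    simp only [not_lt_zero, iff_false]
    exact not_vertexKey_append_true_le_replicate_false _ _
  · obtain ⟨s, hs⟩ : ∃ s, r k = s + 1 := ⟨r k - 1, by omega⟩
    obtain ⟨t, ht⟩ := exists_nodeAddress_eq hle hs
    rw [ht, vertexKey_append_true_le_append_iff, hs, Nat.lt_succ_iff]
    exact (vertexKey_nodeAddress_strictMono hr hle).le_iff_le

theorem nodeAddress_append_true_eq (hle : ∀ k, r k ≤ k) {j k : ℕ} (hk : r k = j + 1)
    (hlt : ∀ l < k, r l ≤ j) : nodeAddress r k = nodeAddress r j ++ [true] := by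
  cases k with
  | zero => have := hle 0; omega
  | succ k =>
    have := hlt k k.lt_succ_self
    exact nodeAddress_succ_of_ne hle (by omega) hk

theorem exists_nodeAddress_eq_of_append (hle : ∀ k, r k ≤ k) {k : ℕ} {v : List Bool} {b : Bool}
    (h : nodeAddress r k = v ++ [b]) : ∃ j < k, nodeAddress r j = v := by
  cases k with
  | zero => rw [nodeAddress_zero] at h; simp at h
  | succ k =>
    by_cases hk : r (k + 1) = r k
    · rw [nodeAddress_succ_of_eq hk] at h
      exact ⟨k, k.lt_succ_self, (List.append_inj' h rfl).1⟩
    · have := hle (k + 1)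
      -- Without monotonicity `r` may drop to 0; the truncated subtraction then selects index 0.
      rcases Nat.eq_zero_or_pos (r (k + 1)) with h0 | h0
      · rw [nodeAddress, if_neg hk] at h
        exact ⟨_, by omega, (List.append_inj' h rfl).1⟩
      · rw [nodeAddress_succ_of_ne hle hk (Nat.sub_add_cancel h0).symm] at h
        exact ⟨_, by omega, (List.append_inj' h rfl).1⟩

theorem length_nodeAddress_le (hle : ∀ k, r k ≤ k) (k : ℕ) : (nodeAddress r k).length ≤ k := by
  induction k using Nat.strong_induction_on with
  | _ k ih =>
    rcases List.eq_nil_or_concat' (nodeAddress r k) with h | ⟨v, b, h⟩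
    · simp [h]
    · obtain ⟨j, hj, rfl⟩ := exists_nodeAddress_eq_of_append hle h
      have := ih j hj
      rw [h, List.length_append, List.length_singleton]
      omega

end NodeAddress

/-! ### Ranks of the values of a point and the tree they define -/

section TreeOfPoint

variable {n : ℕ} (p : Fin n → ℝ)

/-- The number of values of `p` that are smaller than `p i`. -/
noncomputable def valueRank (i : Fin n) : ℕ :=
  ((Finset.univ.image p).filter (· < p i)).card

theorem valueRank_lt {i j : Fin n} (h : p i < p j) : valueRank p i < valueRank p j := by
  refine Finset.card_lt_card ⟨fun x hx => ?_, fun hs => ?_⟩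
  · rw [Finset.mem_filter] at hx ⊢
    exact ⟨hx.1, hx.2.trans h⟩
  · have := @hs (p i) (by simp [h])
    simp at this

theorem valueRank_le_iff {i j : Fin n} : valueRank p i ≤ valueRank p j ↔ p i ≤ p j := by
  refine ⟨fun h => ?_, fun h => ?_⟩
  · by_contra! hlt
    exact (valueRank_lt p hlt).not_ge h
  · rcases h.lt_or_eq with h | h
    · exact (valueRank_lt p h).le
    · simp [valueRank, h]

theorem valueRank_lt_iff {i j : Fin n} : valueRank p i < valueRank p j ↔ p i < p j := by
  rw [← not_le, valueRank_le_iff, not_le]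

theorem valueRank_eq_iff {i j : Fin n} : valueRank p i = valueRank p j ↔ p i = p j := by
  rw [le_antisymm_iff, valueRank_le_iff, valueRank_le_iff, le_antisymm_iff]

theorem valueRank_lt_card (i : Fin n) : valueRank p i < (Finset.univ.image p).card :=
  Finset.card_lt_card ⟨Finset.filter_subset _ _, fun hs => by
    have := @hs (p i) (by simp)
    simp at this⟩

/-- Distinct values have distinct ranks below the number of values, so by counting every such rank
occurs. -/
theorem exists_valueRank_eq {k : ℕ} (hkc : k < (Finset.univ.image p).card) :
    ∃ i, valueRank p i = k := by
  have himg : (Finset.univ.image (valueRank p)) = Finset.range (Finset.univ.image p).card := by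
    refine Finset.eq_of_subset_of_card_le (fun k hk => ?_) ?_
    · obtain ⟨i, -, rfl⟩ := Finset.mem_image.1 hk
      exact Finset.mem_range.2 (valueRank_lt_card p i)
    · rw [Finset.card_range]
      obtain ⟨_, hx⟩ := Finset.card_pos.1 (Nat.zero_lt_of_lt hkc)
      obtain ⟨i, -, -⟩ := Finset.mem_image.1 hx
      have : Nonempty (Fin n) := ⟨i⟩
      choose! s hs using fun x (hx : x ∈ Finset.univ.image p) => Finset.mem_image.1 hx
      refine Finset.card_le_card_of_injOn (fun x => valueRank p (s x)) (fun x _ => by simp) ?_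
      intro x hx y hy hxy
      rw [← (hs x hx).2, ← (hs y hy).2]
      exact (valueRank_eq_iff p).1 hxy
  have := Finset.mem_range.2 hkc
  rw [← himg] at this
  obtain ⟨i, -, hi⟩ := Finset.mem_image.1 this
  exact ⟨i, hi⟩

/-- The number of blocks whose right child comes weakly before the `k`-th block in the tree of
Shi type of the point `p`. -/
noncomputable def shiRank (k : ℕ) : ℕ :=
  ((Finset.univ : Finset (Fin n × Fin n)).filter fun q =>
    q.1 < q.2 ∧ p q.2 + 1 ≤ p q.1 ∧ valueRank p q.1 ≤ k).sup fun q => valueRank p q.2 + 1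

theorem shiRank_le_iff {j k : ℕ} : shiRank p k ≤ j ↔
    ∀ a b, a < b → p b + 1 ≤ p a → valueRank p a ≤ k → valueRank p b < j := by
  simp [shiRank, Finset.sup_le_iff]

theorem lt_shiRank_iff {j k : ℕ} : j < shiRank p k ↔
    ∃ a b, a < b ∧ p b + 1 ≤ p a ∧ valueRank p a ≤ k ∧ j ≤ valueRank p b := by
  rw [← not_le, shiRank_le_iff]
  push Not
  rfl

theorem shiRank_mono : Monotone (shiRank p) := fun _ _ hkl =>
  (shiRank_le_iff p).2 fun a b hab h hk =>
    (lt_shiRank_iff p).2 ⟨a, b, hab, h, hk.trans hkl, le_rfl⟩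

theorem shiRank_le (k : ℕ) : shiRank p k ≤ k :=
  (shiRank_le_iff p).2 fun a b _ h hk =>
    ((valueRank_lt_iff p).2 (by linarith)).trans_le hk

/-- The equalities `p a = p b + 1` with `a < b` are visible as right internal edges. -/
theorem nodeAddress_valueRank_eq {a b : Fin n} (hab : a < b) (h : p a = p b + 1) :
    nodeAddress (shiRank p) (valueRank p a) =
      nodeAddress (shiRank p) (valueRank p b) ++ [true] := by
  -- Any pair counted at the rank of `a` has its lower value at most `p a - 1 = p b`, and strictly
  -- less if counted earlier. So `shiRank` first reaches the rank of `b` plus 1 exactly at `a`.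
  refine nodeAddress_append_true_eq (shiRank_le p) (le_antisymm ?_ ?_) fun l hl => ?_
  · refine (shiRank_le_iff p).2 fun a' b' _ h' hk => Nat.lt_succ_iff.2 ?_
    rw [valueRank_le_iff] at hk ⊢
    linarith
  · exact (lt_shiRank_iff p).2 ⟨a, b, hab, h.ge, le_rfl, le_rfl⟩
  · refine (shiRank_le_iff p).2 fun a' b' _ h' hk => ?_
    have := (valueRank_lt_iff p).1 (hk.trans_lt hl)
    rw [valueRank_lt_iff]
    linarith

open Classical in
/-- The decoration of the `k`-th node in the tree of Shi type of the point `p`. -/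
noncomputable def shiDecoration (k : ℕ) : NodeDecoration n where
  label := Finset.univ.filter fun i => valueRank p i = k
  rightDashed := decide (∃ a b, a < b ∧ p a = p b + 1 ∧ valueRank p b = k)

theorem mem_label_shiDecoration {i : Fin n} {k : ℕ} :
    i ∈ (shiDecoration p k).label ↔ valueRank p i = k := by
  simp [shiDecoration]

theorem rightDashed_shiDecoration {k : ℕ} : (shiDecoration p k).rightDashed = true ↔
    ∃ a b, a < b ∧ p a = p b + 1 ∧ valueRank p b = k := by
  simp [shiDecoration]

theorem exists_tree_of_point : ∃ t : BinaryTree (NodeDecoration n), ∀ v d,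
    t.valueAt v = some d ↔ ∃ k < (Finset.univ.image p).card,
      nodeAddress (shiRank p) k = v ∧ d = shiDecoration p k := by
  classical
  let f : List Bool → Option (NodeDecoration n) := fun v =>
    if h : ∃ k < (Finset.univ.image p).card, nodeAddress (shiRank p) k = v
    then some (shiDecoration p h.choose) else none
  have hN : ∀ v, (Finset.univ.image p).card ≤ v.length → f v = none := by
    refine fun v hv => dif_neg ?_
    rintro ⟨k, hk, rfl⟩
    have := length_nodeAddress_le (shiRank_le p) k
    omega
  have hf : ∀ v b, f v = none → f (v ++ [b]) = none := by
    intro v b hv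
    have hv' : ¬ ∃ k < (Finset.univ.image p).card, nodeAddress (shiRank p) k = v := by
      intro h
      simp [f, dif_pos h] at hv
    refine dif_neg ?_
    rintro ⟨k, hk, h⟩
    obtain ⟨j, hj, h⟩ := exists_nodeAddress_eq_of_append (shiRank_le p) h
    exact hv' ⟨j, hj.trans hk, h⟩
  obtain ⟨t, ht⟩ := BinaryTree.exists_valueAt_eq _ f hN hf
  refine ⟨t, fun v d => ?_⟩
  rw [ht]
  constructor
  · intro h
    simp only [f] at h
    split_ifs at h with hv
    rw [Option.some_inj] at h
    exact ⟨_, hv.choose_spec.1, hv.choose_spec.2, h.symm⟩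
  · rintro ⟨k, hk, rfl, rfl⟩
    have hv : ∃ l < (Finset.univ.image p).card,
      nodeAddress (shiRank p) l = nodeAddress (shiRank p) k := ⟨k, hk, rfl⟩
    simp only [f]
    rw [dif_pos hv, nodeAddress_injective (shiRank_mono p) (shiRank_le p) hv.choose_spec.2]

theorem exists_isShiType_shiConditions :
    ∃ T : DecoratedBinaryTree n, T.IsShiType ∧ T.ShiConditions p := by
  obtain ⟨t, ht⟩ := exists_tree_of_point p
  have hinj := nodeAddress_injective (shiRank_mono p) (shiRank_le p)
  have hmono := vertexKey_nodeAddress_strictMono (shiRank_mono p) (shiRank_le p)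
  have hval : ∀ i, t.valueAt (nodeAddress (shiRank p) (valueRank p i)) =
      some (shiDecoration p (valueRank p i)) := fun i =>
    (ht _ _).2 ⟨_, valueRank_lt_card p i, rfl, rfl⟩
  let T : DecoratedBinaryTree n :=
    { tree := t
      label_nonempty := fun v d h => by
        obtain ⟨k, hk, -, rfl⟩ := (ht v d).1 h
        obtain ⟨i, hi⟩ := exists_valueRank_eq p hk
        exact ⟨i, (mem_label_shiDecoration p).2 hi⟩
      existsUnique_node := fun i => by
        refine ⟨_, ⟨_, hval i, (mem_label_shiDecoration p).2 rfl⟩, ?_⟩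
        rintro v ⟨d, hd, hi⟩
        obtain ⟨k, -, rfl, rfl⟩ := (ht v d).1 hd
        rw [(mem_label_shiDecoration p).1 hi]
      dashed_internal := fun v d hd h => by
        obtain ⟨k, -, rfl, rfl⟩ := (ht v d).1 hd
        obtain ⟨a, b, hab, heq, rfl⟩ := (rightDashed_shiDecoration p).1 h
        exact ⟨_, nodeAddress_valueRank_eq p hab heq ▸ hval a⟩ }
  have hnode : ∀ i, T.nodeOf i = nodeAddress (shiRank p) (valueRank p i) := fun i =>
    DecoratedBinaryTree.nodeOf_eq (hval i) ((mem_label_shiDecoration p).2 rfl)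
  have hcap : ∀ i, T.IsCaptive (T.rightChildOf i) ↔
      ∃ a b, a < b ∧ p a = p b + 1 ∧ p b = p i := fun i => by
    rw [DecoratedBinaryTree.rightChildOf, hnode,
      DecoratedBinaryTree.isCaptive_append_true_iff (hval i), rightDashed_shiDecoration]
    simp only [valueRank_eq_iff]
  have hright : ∀ i j, vertexKey (T.rightChildOf j) ≤ vertexKey (T.nodeOf i) ↔
      ∃ a b, a < b ∧ p b + 1 ≤ p a ∧ p a ≤ p i ∧ p j ≤ p b := fun i j => by
    rw [DecoratedBinaryTree.rightChildOf, hnode, hnode,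
      nodeAddress_append_true_le_iff (shiRank_mono p) (shiRank_le p), lt_shiRank_iff]
    simp only [valueRank_le_iff]
  have hle : ∀ i j, vertexKey (T.nodeOf i) ≤ vertexKey (T.nodeOf j) ↔ p i ≤ p j := fun i j => by
    rw [hnode, hnode, hmono.le_iff_le, valueRank_le_iff]
  refine ⟨T, fun v d e hd he => ?_, fun i j => ?_, fun i j hij => ?_, fun i j hij => ?_⟩
  · obtain ⟨j, hj⟩ := DecoratedBinaryTree.IsNode.exists_nodeOf_eq ⟨d, hd⟩
    obtain ⟨i, hi⟩ := DecoratedBinaryTree.IsNode.exists_nodeOf_eq ⟨e, he⟩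
    -- The pair squeezes: right child of `j` ⪯ right child of `b` ⪯ node of `a` ⪯ node of `i`, whose
    -- ends agree. So `a` lies in the child and `b` in the parent, and `a < b` is the descent.
    obtain ⟨a, b, hab, h, hai, hjb⟩ := (hright i j).1 (by
      rw [DecoratedBinaryTree.rightChildOf, hj, hi])
    have h1 : vertexKey (T.rightChildOf b) ≤ vertexKey (T.nodeOf a) :=
      (hright a b).2 ⟨a, b, hab, h, le_rfl, le_rfl⟩
    rw [← hle] at hai hjb
    have hji : T.nodeOf i = T.rightChildOf j := by rw [DecoratedBinaryTree.rightChildOf, hj, hi]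
    have h2 : vertexKey (T.rightChildOf j) ≤ vertexKey (T.rightChildOf b) :=
      vertexKey_append_true_le_iff.2 hjb
    rw [hji] at hai
    have ha : T.nodeOf a = T.rightChildOf j :=
      vertexKey_injective (hai.antisymm (h2.trans h1))
    have hb : T.nodeOf b = T.nodeOf j :=
      vertexKey_injective ((vertexKey_append_true_le_iff.1 (h1.trans hai)).antisymm hjb)
    have hae : a ∈ e.label := (DecoratedBinaryTree.mem_label_iff he).2 (by rw [ha, ← hji, hi])
    have hbd : b ∈ d.label := (DecoratedBinaryTree.mem_label_iff hd).2 (by rw [hb, hj])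
    exact (Finset.min'_le _ _ hae).trans_lt (hab.trans_le (Finset.le_max' _ _ hbd))
  · rw [vertexLE_iff, hle]
  · rw [vertexLT_iff, ← not_le, ← not_le, hright, not_iff_not]
    refine ⟨fun h => ⟨i, j, hij, h, le_rfl, le_rfl⟩, ?_⟩
    rintro ⟨a, b, -, h, hai, hjb⟩
    linarith
  · rw [hcap]
    constructor
    · intro h
      refine ⟨?_, i, j, hij, h, rfl⟩
      rw [DecoratedBinaryTree.rightChildOf, hnode, hnode, nodeAddress_valueRank_eq p hij h]
    · rintro ⟨hi, a, b, hab, h, hb⟩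
      -- The dashed edge may come from another pair `a < b`; then `a` shares the node of `i` and `b`
      -- that of `j`.
      have ha := nodeAddress_valueRank_eq p hab h
      rw [(valueRank_eq_iff p).2 hb, ← hnode, ← hnode] at ha
      rw [DecoratedBinaryTree.rightChildOf, ← ha] at hi
      have h1 : p i = p a := ((hle i a).1 (by rw [hi])).antisymm ((hle a i).1 (by rw [hi]))
      rw [h1, h, hb]

end TreeOfPoint

theorem mainTheorem8 (n : ℕ) (hn : 1 ≤ n) :
    (∀ T : DecoratedBinaryTree n, T.IsShiType →
      ∃! F : Set (Fin n → ℝ),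
        IsFace (shiArrangement n) F ∧ ∀ p, p ∈ F ↔ T.ShiConditions p) ∧
    ∃ Φ : {T : DecoratedBinaryTree n // T.IsShiType} →
        {F : Set (Fin n → ℝ) // IsFace (shiArrangement n) F},
      (∀ T p, p ∈ (Φ T).1 ↔ T.1.ShiConditions p) ∧
      Function.Bijective Φ ∧
      (∀ T (k : ℕ), T.1.numFree = k ↔ affineDim (Φ T).1 = k) ∧
      (∀ T, IsFace (catalanArrangement n) {p | T.1.CatalanConditions p} ∧
        {p | T.1.CatalanConditions p} ⊆ (Φ T).1 ∧
        ∀ G : Set (Fin n → ℝ), IsFace (shiArrangement n) G →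
          {p | T.1.CatalanConditions p} ⊆ G → G = (Φ T).1) := by
  refine ⟨fun T _ => ⟨{p | T.ShiConditions p}, ⟨T.isFace_setOf_shiConditions, fun _ => Iff.rfl⟩,
    fun F hF => Set.ext hF.2⟩, fun T => ⟨{p | T.1.ShiConditions p},
      T.1.isFace_setOf_shiConditions⟩, fun _ _ => Iff.rfl, ⟨?_, ?_⟩, ?_, ?_⟩
  · rintro ⟨T, hT⟩ ⟨T', hT'⟩ h
    have h' : {p | T.ShiConditions p} = {p | T'.ShiConditions p} := congrArg Subtype.val h
    -- One common point of the two faces suffices to identify the trees.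
    have hp := T.catalanConditions_catalanPoint.shiConditions
    exact Subtype.ext (hT.eq_of_shiConditions hT' hp (h'.subset hp))
  · rintro ⟨F, hF⟩
    obtain ⟨p, hp⟩ := hF.1
    obtain ⟨T, hT, hTp⟩ := exists_isShiType_shiConditions p
    exact ⟨⟨T, hT⟩, Subtype.ext (T.isFace_setOf_shiConditions.eq_of_mem hF hTp hp)⟩
  · rintro ⟨T, hT⟩ k
    rw [← hT.affineDim_eq]
  · intro T
    have hp := T.1.catalanConditions_catalanPoint
    exact ⟨T.1.isFace_setOf_catalanConditions, fun _ h => h.shiConditions, fun G hG hs =>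
      hG.eq_of_mem T.1.isFace_setOf_shiConditions (hs hp) hp.shiConditions⟩
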